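/- Let $\mathcal S,\mathcal A$ be finite sets, $T:\mathcal S\times\mathcal A\to\Delta(\mathcal S)$ a transition function, $R:\mathcal S\times\mathcal A\to\mathbb R$ a reward function, $\gamma\in[0,1)$, $\varnothing\in\mathcal A$ a distinguished (no-op) action, $\lambda\ge 0$, and let $(R_i)_{i\in I}$ be a finite family of auxiliary reward functions $R_i:\mathcal S\times\mathcal A\to\mathbb R$. On a probability space with a filtration $(\mathcal F_n)_{n\ge0}$ let $(s_n,a_n,s_n')_{n\ge 0}$ be a sequence of experiences in the MDP: $s_n,a_n$ are $\mathcal F_n$-measurable, $s_n'$ is $\mathcal F_{n+1}$-measurable, and the conditional law of $s'_n$ given $\mathcal F_n$ is $T(s_n,a_n)$. (A single trajectory, $s_{n+1}=s_n'$, is a special case.) The behaviour policy is arbitrary, in particular it may be greedy in the limit, but almost surely every pair $(s,a)\in\mathcal S\times\mathcal A$ is visited infinitely often. Let $\alpha_n\ge 0$ be $\mathcal F_n$-measurable learning rates such that almost surely, for all $(s,a)$, $$\sum_{n:\,(s_n,a_n)=(s,a)}\alpha_n=\infty,\qquad \sum_{n:\,(s_n,a_n)=(s,a)}\alpha_n^2<\infty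 .$$ Start from arbitrary $\mathcal F_0$-measurable functions $Q_{i,0}$ ($i\in I$) and $Q_{\mathrm{AUP},0}$ on $\mathcal S\times\mathcal A$. For $j\in I\cup\{\mathrm{AUP}\}$ define $Q_{j,n+1}$ by $$Q_{j,n+1}(s_n,a_n)=Q_{j,n}(s_n,a_n)+\alpha_n\Big(\rho_{j,n}+\gamma\max_{a'}Q_{j,n}(s_n',a')-Q_{j,n}(s_n,a_n)\Big),$$ and $Q_{j,n+1}=Q_{j,n}$ at all other pairs, where $\rho_{i,n}=R_i(s_n,a_n)$ for $i\in I$ and $$\rho_{\mathrm{AUP},n}=R(s_n,a_n)-\lambda\,\frac{\mathrm{Penalty}_{n+\delta}(s_n,a_n)}{\mathrm{Scale}_{n+\delta}(s_n)},\qquad \mathrm{Penalty}_k(s,a)=\sum_{i\in I}\big|Q_{i,k}(s,a)-Q_{i,k}(s,\varnothing)\big| .$$ Here $\delta\in\{0,1\}$ is fixed and says whether the AUP reward is computed before ($\delta=0$) or after ($\delta=1$) the auxiliary updates of the same step. $\mathrm{Scale}_n(s)$ is any real-valued $\mathcal F_n$-measurable quantity, for example a measurable function of the current auxiliary Q-functions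 such as $\sum_{i\in I} Q_{i,n}(s,\varnothing)$. Assume that almost surely, for every $s$, $\mathrm{Scale}_n(s)$ converges as $n\to\infty$ to a limit $\mathrm{Scale}^*(s)>0$. (A quotient with denominator $0$, which can then occur only finitely often, is read as $0$.) Call $Q$ optimal for a reward function $r$ if $Q(s,a)=r(s,a)+\gamma\sum_{s'}T(s,a)(s')\max_{a'}Q(s',a')$ for all $(s,a)$. Then for every $i\in I$ there is a $Q_i^*$ that is optimal for $R_i$, such that almost surely $Q_{i,n}(s,a)\to Q_i^*(s,a)$ for all $i\in I$ and all $(s,a)$, and such that almost surely $Q_{\mathrm{AUP},n}(s,a)$ converges for all $(s,a)$, the limit being optimal for the reward function $$R^*_{\mathrm{AUP}}(s,a)=R(s,a)-\lambda\,\frac{\sum_{i\in I}|Q_i^*(s,a)-Q_i^*(s,\varnothing)|}{\mathrm{Scale}^*(s)} .$$ -/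

import Mathlib

open MeasureTheory ProbabilityTheory Filter Topology

noncomputable section

namespace AUP

/-- `Q` solves the Bellman optimality equation of the MDP with transition function `T`, reward `r`
and discount factor `γ` (for `γ ∈ [0,1)` its only solution is the optimal Q-function). -/
def IsOptimalQ {S A : Type*} [Fintype S] (T : S → A → PMF S) (γ : ℝ) (r Q : S → A → ℝ) : Prop :=
  ∀ s a, Q s a = r s a + γ * ∑ s', (T s a s').toReal * ⨆ a', Q s' a'

/-- The penalty of action `a` in state `s`, computed from the auxiliary Q-functions `Q`. -/
def penalty {S A ι : Type*} [Fintype ι] (noop : A) (Q : ι → S → A → ℝ) (s : S) (a : A) : ℝ :=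
  ∑ i, |Q i s a - Q i s noop|

/-- The reward `R - lam * Penalty / Scale`, computed from the auxiliary Q-functions `Q` and the
scale `sc`. -/
def aupReward {S A ι : Type*} [Fintype ι] (noop : A) (R : S → A → ℝ) (lam : ℝ)
    (Q : ι → S → A → ℝ) (sc : S → ℝ) (s : S) (a : A) : ℝ :=
  R s a - lam * (penalty noop Q s a / sc s)

open Classical in
/-- One tabular Q-learning update, with learning rate `α`, after taking action `a` in state `s`,
receiving the reward `r` and observing the next state `s'`. -/
def qUpdate {S A : Type*} (γ α r : ℝ) (s : S) (a : A) (s' : S) (Q : S → A → ℝ) : S → A → ℝ :=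
  fun x b => if x = s ∧ b = a then Q s a + α * (r + γ * (⨆ a', Q s' a') - Q s a) else Q x b

/-- The auxiliary Q-functions after `n` steps. At step `n` action `U n` is taken in state `X n`, the
next state `Y n` is observed, and every auxiliary Q-function is updated for its own reward. -/
def auxQ {Ω S A ι : Type*} (γ : ℝ) (r : ι → S → A → ℝ)
    (X : ℕ → Ω → S) (U : ℕ → Ω → A) (Y : ℕ → Ω → S) (α : ℕ → Ω → ℝ)
    (q₀ : Ω → ι → S → A → ℝ) : ℕ → Ω → ι → S → A → ℝ
  | 0 => q₀
  | n + 1 => fun ω i =>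
      qUpdate γ (α n ω) (r i (X n ω) (U n ω)) (X n ω) (U n ω) (Y n ω)
        (auxQ γ r X U Y α q₀ n ω i)

/-- The Q-function learned for the AUP reward, after `n` steps. The reward at step `n` is
computed from the auxiliary Q-functions and the scale in force at time `n + δ`: for `δ = 0` these
are the values before, for `δ = 1` the values after the auxiliary updates of that step. -/
def aupQ {Ω S A ι : Type*} [Fintype ι] (noop : A) (γ lam : ℝ) (R : S → A → ℝ)
    (r : ι → S → A → ℝ) (X : ℕ → Ω → S) (U : ℕ → Ω → A) (Y : ℕ → Ω → S) (α : ℕ → Ω → ℝ)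
    (q₀ : Ω → ι → S → A → ℝ) (Sc : ℕ → Ω → S → ℝ) (δ : ℕ) (p₀ : Ω → S → A → ℝ) :
    ℕ → Ω → S → A → ℝ
  | 0 => p₀
  | n + 1 => fun ω =>
      qUpdate γ (α n ω)
        (aupReward noop R lam (auxQ γ r X U Y α q₀ (n + δ) ω) (Sc (n + δ) ω) (X n ω) (U n ω))
        (X n ω) (U n ω) (Y n ω)
        (aupQ noop γ lam R r X U Y α q₀ Sc δ p₀ n ω)

/-- `(X n, U n, Y n)` is a sequence of experiences in an MDP with transition function `T`: given the
history `ℱ n`, which determines the state `X n` and the (arbitrarily chosen) action `U n`, the next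
state `Y n` has law `T (X n) (U n)`. A single trajectory is the case `X (n + 1) = Y n`; not
requiring this equation allows for episodes and resets. -/
structure IsExperience {Ω S A : Type*} {m : MeasurableSpace Ω} [MeasurableSpace S]
    [MeasurableSpace A] (μ : Measure Ω) (ℱ : Filtration ℕ m) (T : S → A → PMF S)
    (X : ℕ → Ω → S) (U : ℕ → Ω → A) (Y : ℕ → Ω → S) : Prop where
  measurable_state : ∀ n, Measurable[ℱ n] (X n)
  measurable_action : ∀ n, Measurable[ℱ n] (U n)
  measurable_next : ∀ n, Measurable[ℱ (n + 1)] (Y n)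
  law_next : ∀ n s', μ⟦Y n ⁻¹' {s'} | ℱ n⟧ =ᵐ[μ] fun ω => (T (X n ω) (U n ω) s').toReal

/-- Infinite exploration: almost surely every state-action pair is visited infinitely often. -/
def InfiniteExploration {Ω S A : Type*} {m : MeasurableSpace Ω} (μ : Measure Ω)
    (X : ℕ → Ω → S) (U : ℕ → Ω → A) : Prop :=
  ∀ᵐ ω ∂μ, ∀ s a, ∃ᶠ n in atTop, X n ω = s ∧ U n ω = a

/-- `α` is a learning rate schedule with infinite sum and finite sum of squares: the rates are
nonnegative, known when they are used, and almost surely, for every state-action pair, the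
rates used at the visits to that pair have infinite sum and finite sum of squares. -/
structure IsLearningRate {Ω S A : Type*} {m : MeasurableSpace Ω} (μ : Measure Ω)
    (ℱ : Filtration ℕ m) (X : ℕ → Ω → S) (U : ℕ → Ω → A) (α : ℕ → Ω → ℝ) : Prop where
  measurable : ∀ n, Measurable[ℱ n] (α n)
  nonneg : ∀ n ω, 0 ≤ α n ω
  sum_eq_top : ∀ᵐ ω ∂μ, ∀ s a, ¬ Summable ({n | X n ω = s ∧ U n ω = a}.indicator fun n => α n ω)
  summable_sq : ∀ᵐ ω ∂μ, ∀ s a,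
    Summable ({n | X n ω = s ∧ U n ω = a}.indicator fun n => α n ω ^ 2)

end AUP

end

/-! Q-learning is an asynchronous stochastic approximation of the fixed point of a `γ`-contraction
in the sup norm. One result, `AUP.ae_tendsto_of_qUpdate`, covers any adapted Q-learning process
whose rewards differ from a fixed reward function by an error tending to `0`. For the auxiliary
functions the error is zero. Once they converge, so does the AUP reward, and the result applies
again.

No boundedness of the iterates is known in advance, so the sampling noise is divided by the running
maximum `G` of the norms. The quotients have bounded predictable weights, and their sums converge
almost surely by an L² martingale argument (`ae_exists_tendsto_sum_mul_of_summable_sq`).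

The rest is pathwise (`IsScheme.tendsto`). After a late restart the sums of the normalised noise
stay below `ε`, so the accumulated noise is at most `2 * ε * G`. Since `γ + 2 * ε < 1`, this forces
`G` to be bounded. Then every eventual bound `c` on the distance to the fixed point improves to `γ *
c + η`, and iteration drives it to `0`. -/

section Deterministic

/-! ### Pathwise convergence of asynchronous stochastic approximation -/

theorem abs_le_of_averaging {a y D : ℕ → ℝ} {c : ℝ} {N : ℕ}
    (ha₀ : ∀ n, 0 ≤ a n) (ha₁ : ∀ n, a n ≤ 1)
    (hD : ∀ n, D (n + 1) = (1 - a n) * D n + a n * y n)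
    (hy : ∀ n < N, |y n| ≤ c) (h₀ : |D 0| ≤ c) : ∀ n ≤ N, |D n| ≤ c := by
  intro n
  induction n with
  | zero => exact fun _ => h₀
  | succ n ih =>
    intro hn
    have h1 := ih (by omega)
    have h2 := hy n (by omega)
    have h3 : 0 ≤ 1 - a n := sub_nonneg.2 (ha₁ n)
    rw [hD]
    calc |(1 - a n) * D n + a n * y n| ≤ |(1 - a n) * D n| + |a n * y n| := abs_add_le _ _
      _ = (1 - a n) * |D n| + a n * |y n| := by
        rw [abs_mul, abs_mul, abs_of_nonneg h3, abs_of_nonneg (ha₀ n)]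
      _ ≤ (1 - a n) * c + a n * c := by
        gcongr
        exact ha₀ n
      _ = c := by ring

theorem tendsto_prod_one_sub_zero {a : ℕ → ℝ} (ha₀ : ∀ n, 0 ≤ a n) (ha₁ : ∀ n, a n ≤ 1)
    (ha : ¬ Summable a) :
    Tendsto (fun n => ∏ k ∈ Finset.range n, (1 - a k)) atTop (𝓝 0) := by
  have h1 := (not_summable_iff_tendsto_nat_atTop_of_nonneg ha₀).1 ha
  have h2 := Real.tendsto_exp_neg_atTop_nhds_zero.comp h1
  refine squeeze_zero (fun n => Finset.prod_nonneg fun k _ => sub_nonneg.2 (ha₁ k)) (fun n => ?_) h2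
  simp only [Function.comp_apply, ← Finset.sum_neg_distrib, Real.exp_sum]
  refine Finset.prod_le_prod (fun k _ => sub_nonneg.2 (ha₁ k)) fun k _ => ?_
  linarith [Real.add_one_le_exp (-a k)]

theorem eventually_abs_le_of_averaging {a y D : ℕ → ℝ} {c : ℝ}
    (ha₀ : ∀ n, 0 ≤ a n) (ha₁ : ∀ n, a n ≤ 1) (ha : ¬ Summable a)
    (hD : ∀ n, D (n + 1) = (1 - a n) * D n + a n * y n)
    (hy : ∀ n, |y n| ≤ c) {η : ℝ} (hη : 0 < η) : ∀ᶠ n in atTop, |D n| ≤ c + η := by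
  -- The initial value is forgotten at the rate `∏ (1 - a k)`, which tends to `0`.
  have key : ∀ n, |D n| ≤ c + |D 0| * ∏ k ∈ Finset.range n, (1 - a k) := by
    have hc : 0 ≤ c := (abs_nonneg _).trans (hy 0)
    intro n
    induction n with
    | zero => simpa using hc
    | succ n ih =>
      have h3 : 0 ≤ 1 - a n := sub_nonneg.2 (ha₁ n)
      rw [hD, Finset.prod_range_succ]
      calc |(1 - a n) * D n + a n * y n| ≤ |(1 - a n) * D n| + |a n * y n| := abs_add_le _ _
        _ = (1 - a n) * |D n| + a n * |y n| := by
          rw [abs_mul, abs_mul, abs_of_nonneg h3, abs_of_nonneg (ha₀ n)]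
        _ ≤ (1 - a n) * (c + |D 0| * ∏ k ∈ Finset.range n, (1 - a k)) + a n * c :=
          add_le_add (mul_le_mul_of_nonneg_left ih h3) (mul_le_mul_of_nonneg_left (hy n) (ha₀ n))
        _ = _ := by ring
  have h := (tendsto_prod_one_sub_zero ha₀ ha₁ ha).const_mul |D 0|
  rw [mul_zero] at h
  filter_upwards [h.eventually_lt_const hη] with n hn
  linarith [key n]

/-- The solution of `W (n + 1) = (1 - a n) * W n + G n * d n` that starts from `0`. -/
noncomputable def averagedNoise (a G d : ℕ → ℝ) : ℕ → ℝ
  | 0 => 0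
  | n + 1 => (1 - a n) * averagedNoise a G d n + G n * d n

/-- Summation by parts: only the partial sums of `d` are small, not `∑ |d k|`. The difference from
`G n * ∑ d k` is averaged against terms of size `ε * G n`, and each growth of `G` adds at most `ε`
times that growth. Hence it stays below `ε * G n`. -/
theorem abs_averagedNoise_le {a G d : ℕ → ℝ} {ε : ℝ}
    (ha₀ : ∀ n, 0 ≤ a n) (ha₁ : ∀ n, a n ≤ 1) (hG₀ : 0 ≤ G 0) (hG : Monotone G)
    (hd : ∀ n, |∑ k ∈ Finset.range n, d k| ≤ ε) (n : ℕ) :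
    |averagedNoise a G d n| ≤ 2 * ε * G n := by
  have hGn : ∀ n, 0 ≤ G n := fun n => hG₀.trans (hG (Nat.zero_le n))
  have hε : 0 ≤ ε := (abs_nonneg _).trans (hd 0)
  have key : ∀ n, |averagedNoise a G d n - G n * ∑ k ∈ Finset.range n, d k| ≤ ε * G n := by
    intro n
    induction n with
    | zero => simpa [averagedNoise] using mul_nonneg hε hG₀
    | succ n ih =>
      have h1 := hd n
      have h2 := hd (n + 1)
      have h3 : 0 ≤ 1 - a n := sub_nonneg.2 (ha₁ n)
      have h4 : 0 ≤ G (n + 1) - G n := sub_nonneg.2 (hG n.le_succ)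
      have e : averagedNoise a G d (n + 1) - G (n + 1) * ∑ k ∈ Finset.range (n + 1), d k
          = (1 - a n) * (averagedNoise a G d n - G n * ∑ k ∈ Finset.range n, d k)
            - a n * G n * ∑ k ∈ Finset.range n, d k
            - (G (n + 1) - G n) * ∑ k ∈ Finset.range (n + 1), d k := by
        rw [averagedNoise, Finset.sum_range_succ]
        ring
      rw [e]
      refine (abs_sub _ _).trans ?_
      refine (add_le_add (abs_sub _ _) le_rfl).trans ?_
      rw [abs_mul, abs_mul, abs_mul (G (n + 1) - G n), abs_of_nonneg h3, abs_of_nonneg h4,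
        abs_of_nonneg (mul_nonneg (ha₀ n) (hGn n))]
      have := mul_le_mul_of_nonneg_left ih h3
      have := mul_le_mul_of_nonneg_left h1 (mul_nonneg (ha₀ n) (hGn n))
      have := mul_le_mul_of_nonneg_left h2 h4
      linarith
  have h1 := key n
  have h2 : |G n * ∑ k ∈ Finset.range n, d k| ≤ G n * ε := by
    rw [abs_mul, abs_of_nonneg (hGn n)]
    exact mul_le_mul_of_nonneg_left (hd n) (hGn n)
  have h3 := abs_add_le (averagedNoise a G d n - G n * ∑ k ∈ Finset.range n, d k)
    (G n * ∑ k ∈ Finset.range n, d k)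
  rw [sub_add_cancel] at h3
  linarith

/-- `q` follows an asynchronous stochastic approximation scheme with step sizes `a`, targets `y` and
noise increments `G n * d n x`, where `G n` is the running maximum of `‖q n‖`. -/
structure IsScheme {κ : Type*} [Fintype κ] (q a y d : ℕ → κ → ℝ) (G : ℕ → ℝ) : Prop where
  step : ∀ n x, q (n + 1) x = (1 - a n x) * q n x + a n x * y n x + G n * d n x
  rate_nonneg : ∀ n x, 0 ≤ a n x
  norm_le : ‖q 0‖ ≤ G 0
  max_succ : ∀ n, G (n + 1) = max (G n) ‖q (n + 1)‖

namespace IsScheme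

variable {κ : Type*} [Fintype κ] {q a y d : ℕ → κ → ℝ} {G : ℕ → ℝ}

theorem monotone (h : IsScheme q a y d G) : Monotone G :=
  monotone_nat_of_le_succ fun n => by rw [h.max_succ]; exact le_max_left _ _

theorem norm_le_max (h : IsScheme q a y d G) (n : ℕ) : ‖q n‖ ≤ G n := by
  cases n with
  | zero => exact h.norm_le
  | succ n => rw [h.max_succ]; exact le_max_right _ _

theorem max_nonneg (h : IsScheme q a y d G) (n : ℕ) : 0 ≤ G n :=
  (norm_nonneg _).trans (h.norm_le_max n)

theorem max_le (h : IsScheme q a y d G) {B : ℝ} (h₀ : G 0 ≤ B) :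
    ∀ n, (∀ k ≤ n, ‖q k‖ ≤ B) → G n ≤ B := by
  intro n
  induction n with
  | zero => exact fun _ => h₀
  | succ n ih =>
    intro hk
    rw [h.max_succ]
    exact _root_.max_le (ih fun k hkn => hk k (by omega)) (hk _ le_rfl)

/-- The maximum `G` is not restarted; this is why `IsScheme` only asks for `‖q 0‖ ≤ G 0`. -/
theorem shift (h : IsScheme q a y d G) (m : ℕ) :
    IsScheme (fun n => q (n + m)) (fun n => a (n + m)) (fun n => y (n + m))
      (fun n => d (n + m)) (fun n => G (n + m)) where
  step n x := by rw [Nat.add_right_comm]; exact h.step _ x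
  rate_nonneg n x := h.rate_nonneg _ x
  norm_le := h.norm_le_max _
  max_succ n := by rw [Nat.add_right_comm]; exact h.max_succ _

theorem sub_averagedNoise_succ (h : IsScheme q a y d G) (n : ℕ) (x : κ) :
    q (n + 1) x - averagedNoise (a · x) G (d · x) (n + 1)
      = (1 - a n x) * (q n x - averagedNoise (a · x) G (d · x) n) + a n x * y n x := by
  rw [h.step, averagedNoise]
  ring

/-- Up to time `N`, `q` minus its accumulated noise averages targets of size at most `γ * G N + C`,
and the noise is at most `2 * ε * G N`. The resulting inequality `G N ≤ G 0 + C + (γ + 2 * ε) * G N`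
is solved for `G N`. -/
theorem max_bounded (h : IsScheme q a y d G) (ha₁ : ∀ n x, a n x ≤ 1) {ε γ C : ℝ}
    (hd : ∀ n x, |∑ k ∈ Finset.range n, d k x| ≤ ε) (hγ₀ : 0 ≤ γ) (hε₀ : 0 ≤ ε)
    (hC : 0 ≤ C) (hγ : γ + 2 * ε < 1)
    (hy : ∀ n x, |y n x| ≤ γ * ‖q n‖ + C) (N : ℕ) : G N ≤ (G 0 + C) / (1 - γ - 2 * ε) := by
  have hG := h.max_nonneg
  have key : G N ≤ G 0 + C + γ * G N + 2 * ε * G N := by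
    have hn1 := mul_nonneg hγ₀ (hG N)
    have hn2 := mul_nonneg hε₀ (hG N)
    have hn3 := hG 0
    refine h.max_le (by linarith) N fun n hn => ?_
    refine (pi_norm_le_iff_of_nonneg (by linarith)).2 fun x => ?_
    have h1 := abs_averagedNoise_le (h.rate_nonneg · x) (ha₁ · x) (hG 0) h.monotone (hd · x) n
    have h2 : |q n x - averagedNoise (a · x) G (d · x) n| ≤ G 0 + C + γ * G N := by
      refine abs_le_of_averaging (D := fun n => q n x - averagedNoise (a · x) G (d · x) n)
        (h.rate_nonneg · x) (ha₁ · x) (h.sub_averagedNoise_succ · x) (N := N)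
        (fun k hk => ?_) ?_ n hn
      · have h3 := mul_le_mul_of_nonneg_left ((h.norm_le_max k).trans (h.monotone hk.le)) hγ₀
        linarith [hy k x]
      · have h3 := (norm_le_pi_norm (q 0) x).trans (h.norm_le_max 0)
        simp only [averagedNoise, sub_zero]
        rw [Real.norm_eq_abs] at h3
        linarith
    have h3 := abs_add_le (q n x - averagedNoise (a · x) G (d · x) n)
      (averagedNoise (a · x) G (d · x) n)
    have h4 := mul_le_mul_of_nonneg_left (h.monotone hn) hε₀
    rw [sub_add_cancel] at h3
    rw [Real.norm_eq_abs]
    linarith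
  rw [le_div_iff₀ (by linarith)]
  linarith

theorem eventually_norm_sub_le (h : IsScheme q a y d G) (ha₁ : ∀ n x, a n x ≤ 1)
    (ha : ∀ x, ¬ Summable (a · x)) {qlim : κ → ℝ} {ε B c η : ℝ}
    (hd : ∀ n x, |∑ k ∈ Finset.range n, d k x| ≤ ε) (hB : ∀ n, G n ≤ B) (hε₀ : 0 ≤ ε)
    (hc : 0 ≤ c) (hy : ∀ n x, |y n x - qlim x| ≤ c) (hη : 0 < η) :
    ∀ᶠ n in atTop, ‖q n - qlim‖ ≤ c + η + 2 * ε * B := by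
  have hG := h.max_nonneg
  have key : ∀ x, ∀ᶠ n in atTop, |q n x - averagedNoise (a · x) G (d · x) n - qlim x| ≤ c + η := by
    intro x
    refine eventually_abs_le_of_averaging (a := (a · x)) (y := fun n => y n x - qlim x)
      (h.rate_nonneg · x) (ha₁ · x) (ha x) (fun n => ?_) (hy · x) hη
    rw [h.sub_averagedNoise_succ]
    ring
  filter_upwards [eventually_all.2 key] with n hn
  have hB₀ : 0 ≤ B := (hG 0).trans (hB 0)
  refine (pi_norm_le_iff_of_nonneg (by positivity)).2 fun x => ?_
  have h1 := abs_averagedNoise_le (h.rate_nonneg · x) (ha₁ · x) (hG 0) h.monotone (hd · x) n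
  have h2 := mul_le_mul_of_nonneg_left (hB n) hε₀
  have h3 := abs_add_le (q n x - averagedNoise (a · x) G (d · x) n - qlim x)
    (averagedNoise (a · x) G (d · x) n)
  have h4 := hn x
  rw [Pi.sub_apply, Real.norm_eq_abs]
  rw [sub_right_comm, sub_add_cancel, ← sub_right_comm] at h3
  linarith

theorem eventually_abs_sum_shift_le (hd : ∀ x, ∃ l, Tendsto (fun n => ∑ k ∈ Finset.range n, d k x)
    atTop (𝓝 l)) {ε : ℝ} (hε : 0 < ε) :
    ∀ᶠ m in atTop, ∀ n x, |∑ k ∈ Finset.range n, d (k + m) x| ≤ ε := by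
  suffices hx : ∀ x, ∀ᶠ m in atTop, ∀ n, |∑ k ∈ Finset.range n, d (k + m) x| ≤ ε by
    filter_upwards [eventually_all.2 hx] with m hm n x using hm x n
  intro x
  obtain ⟨l, hl⟩ := hd x
  obtain ⟨M, hM⟩ := Metric.cauchySeq_iff.1 hl.cauchySeq ε hε
  filter_upwards [eventually_ge_atTop M] with m hm n
  have h1 := hM (m + n) (by omega) m hm
  rw [Real.dist_eq, Finset.sum_range_add_sub_sum_range] at h1
  simpa [add_comm m] using h1.le

theorem tendsto (h : IsScheme q a y d G)
    (ha₁ : ∀ x, ∀ᶠ n in atTop, a n x ≤ 1) (ha : ∀ x, ¬ Summable (a · x))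
    (hd : ∀ x, ∃ l, Tendsto (fun n => ∑ k ∈ Finset.range n, d k x) atTop (𝓝 l))
    {qlim : κ → ℝ} {γ : ℝ} (hγ₀ : 0 ≤ γ) (hγ₁ : γ < 1) {e : ℕ → ℝ} (he : Tendsto e atTop (𝓝 0))
    (hy : ∀ n x, |y n x - qlim x| ≤ γ * ‖q n - qlim‖ + e n) :
    Tendsto q atTop (𝓝 qlim) := by
  have ha₁' : ∀ᶠ m in atTop, ∀ n x, a (n + m) x ≤ 1 := by
    obtain ⟨M, hM⟩ := eventually_atTop.1 (eventually_all.2 ha₁)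
    filter_upwards [eventually_ge_atTop M] with m hm n x using hM _ (by omega) x
  have hsmall : ∀ η > 0, ∀ᶠ m in atTop, ∀ n, e (n + m) ≤ η := by
    intro η hη
    obtain ⟨M, hM⟩ := eventually_atTop.1 (he.eventually_le_const hη)
    filter_upwards [eventually_ge_atTop M] with m hm n using hM _ (by omega)
  -- boundedness
  obtain ⟨B, hB⟩ : ∃ B, ∀ n, G n ≤ B := by
    -- With this `ε`, `γ + 2 * ε = (1 + γ) / 2 < 1`.
    have hε : 0 < (1 - γ) / 4 := by linarith
    obtain ⟨m, h1, h2, h3⟩ := (ha₁'.and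
      ((eventually_abs_sum_shift_le hd hε).and (hsmall 1 one_pos))).exists
    refine ⟨_, fun n => (h.monotone (Nat.le_add_right n m)).trans
      ((h.shift m).max_bounded h1 h2 hγ₀ hε.le (C := 2 * ‖qlim‖ + 1) (by positivity)
        (by linarith) (fun n x => ?_) n)⟩
    have h4 := hy (n + m) x
    have h5 := h3 n
    have h6 := norm_sub_le (q (n + m)) qlim
    have h7 := norm_le_pi_norm qlim x
    have h8 := abs_add_le (y (n + m) x - qlim x) (qlim x)
    have h9 := mul_le_mul_of_nonneg_left h6 hγ₀
    have h10 := mul_le_mul_of_nonneg_right hγ₁.le (norm_nonneg qlim)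
    rw [sub_add_cancel] at h8
    rw [Real.norm_eq_abs] at h7
    linarith
  have hB₀ : 0 ≤ B := (h.max_nonneg 0).trans (hB 0)
  -- contraction of eventual bounds
  have step : ∀ c, 0 ≤ c → (∀ᶠ n in atTop, ‖q n - qlim‖ ≤ c) → ∀ η > 0,
      ∀ᶠ n in atTop, ‖q n - qlim‖ ≤ γ * c + η := by
    intro c hc hqc η hη
    -- `η` is split into thirds: target error, forgetting of the initial value, and noise `2 * ε *
    -- B`. The `+ 1` covers `B = 0`.
    have hε : 0 < η / (6 * (B + 1)) := by positivity
    obtain ⟨M, hM⟩ := eventually_atTop.1 hqc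
    obtain ⟨m, h1, h2, h3, h4⟩ := (ha₁'.and ((eventually_abs_sum_shift_le hd hε).and
      ((hsmall (η / 3) (by linarith)).and (eventually_ge_atTop M)))).exists
    have h5 := (h.shift m).eventually_norm_sub_le h1 (qlim := qlim) (c := γ * c + η / 3)
      (fun x hx => ha x ((summable_nat_add_iff m).1 hx)) h2 (fun n => hB _) hε.le (by positivity)
      (fun n x => by
        have h6 := mul_le_mul_of_nonneg_left (hM (n + m) (by omega)) hγ₀
        linarith [hy (n + m) x, h3 n]) (η := η / 3) (by linarith)
    have h6 : 2 * (η / (6 * (B + 1))) * B ≤ η / 3 := by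
      rw [show 2 * (η / (6 * (B + 1))) * B = η / 3 * (B / (B + 1)) by field_simp; ring]
      have : B / (B + 1) ≤ 1 := (div_le_one (by linarith)).2 (by linarith)
      nlinarith
    have h7 : ∀ᶠ n in atTop, ‖q (n + m) - qlim‖ ≤ γ * c + η := by
      filter_upwards [h5] with n hn
      linarith
    exact (eventually_map (P := fun n => ‖q n - qlim‖ ≤ γ * c + η)).1 (by
      rw [← map_add_atTop_eq_nat m] ; exact h7)
  -- the eventual bounds form a set with infimum zero
  have hlim : ∀ k : ℕ, ∀ η > 0, ∀ᶠ n in atTop, ‖q n - qlim‖ ≤ γ ^ k * (B + ‖qlim‖) + η := by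
    intro k
    induction k with
    | zero =>
      intro η hη
      filter_upwards with n
      linarith [norm_sub_le (q n) qlim, h.norm_le_max n, hB n]
    | succ k ih =>
      intro η hη
      have h1 := step _ (by positivity) (ih (η / 2) (by linarith)) (η / 2) (by linarith)
      filter_upwards [h1] with n hn
      refine hn.trans ?_
      have := mul_le_mul_of_nonneg_right hγ₁.le (by positivity : 0 ≤ η / 2)
      rw [pow_succ]
      linarith
  rw [tendsto_iff_norm_sub_tendsto_zero, Metric.tendsto_atTop']
  intro ε hε
  have hp := (tendsto_pow_atTop_nhds_zero_of_lt_one hγ₀ hγ₁).mul_const (B + ‖qlim‖)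
  rw [zero_mul] at hp
  obtain ⟨k, hk⟩ := (hp.eventually_lt_const (half_pos hε)).exists
  obtain ⟨M, hM⟩ := eventually_atTop.1 (hlim k (ε / 4) (by linarith))
  refine ⟨M, fun n hn => ?_⟩
  rw [Real.dist_eq, sub_zero, abs_of_nonneg (norm_nonneg _)]
  linarith [hM n hn.le]

end IsScheme

end Deterministic

/-! ### Almost sure convergence of martingale transforms -/

section MartingaleTransform

variable {Ω : Type*} {m : MeasurableSpace Ω} {μ : Measure Ω} [IsProbabilityMeasure μ]
  {ℱ : Filtration ℕ m} {ξ β : ℕ → Ω → ℝ}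

/-- The deterministic bound `K` makes all terms bounded, hence integrable. Increments are
orthogonal, so the second moments stay below `K`. The martingale is thus bounded in L¹ and Doob's
theorem applies. -/
theorem ae_exists_tendsto_sum_mul_of_sum_sq_le
    (hξm : ∀ n, Measurable[ℱ (n + 1)] (ξ n)) (hξ : ∀ n ω, |ξ n ω| ≤ 1)
    (hξc : ∀ n, μ[ξ n | ℱ n] =ᵐ[μ] 0) (hβm : ∀ n, Measurable[ℱ n] (β n)) {K : ℝ}
    (hβ : ∀ n ω, ∑ k ∈ Finset.range n, β k ω ^ 2 ≤ K) :
    ∀ᵐ ω ∂μ, ∃ l, Tendsto (fun n => ∑ k ∈ Finset.range n, β k ω * ξ k ω) atTop (𝓝 l) := by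
  obtain ⟨ω₀⟩ : Nonempty Ω := nonempty_of_isProbabilityMeasure μ
  have hK : 0 ≤ K := by simpa using hβ 0 ω₀
  have hβ1 : ∀ n ω, |β n ω| ≤ K + 1 := by
    intro n ω
    refine abs_le_of_sq_le_sq ?_ (by positivity)
    have h1 : β n ω ^ 2 ≤ ∑ k ∈ Finset.range (n + 1), β k ω ^ 2 :=
      Finset.single_le_sum (f := fun k => β k ω ^ 2) (fun k _ => sq_nonneg _)
        (Finset.self_mem_range_succ n)
    nlinarith [hβ (n + 1) ω]
  set M : ℕ → Ω → ℝ := fun n ω => ∑ k ∈ Finset.range n, β k ω * ξ k ω with hM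
  have hMm : ∀ n, Measurable[ℱ n] (M n) := fun n =>
    Finset.measurable_sum _ fun k hk =>
      ((hβm k).mono (ℱ.mono (Finset.mem_range.1 hk).le) le_rfl).mul
        ((hξm k).mono (ℱ.mono (Finset.mem_range.1 hk)) le_rfl)
  have hbm : ∀ n ω, |β n ω * ξ n ω| ≤ K + 1 := fun n ω => by
    rw [abs_mul]
    exact (mul_le_mul (hβ1 n ω) (hξ n ω) (abs_nonneg _) (by positivity)).trans (mul_one _).le
  have hMb : ∀ n ω, |M n ω| ≤ n * (K + 1) := fun n ω => by
    refine (Finset.abs_sum_le_sum_abs _ _).trans ((Finset.sum_le_card_nsmul _ _ _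
      fun k _ => hbm k ω).trans ?_)
    simp [mul_add]
  have hmβ : ∀ n, Measurable (β n) := fun n => (hβm n).mono (ℱ.le n) le_rfl
  have hmξ : ∀ n, Measurable (ξ n) := fun n => (hξm n).mono (ℱ.le _) le_rfl
  have hmM : ∀ n, Measurable (M n) := fun n => (hMm n).mono (ℱ.le n) le_rfl
  have hint : ∀ {f : Ω → ℝ} {C : ℝ}, Measurable f → (∀ ω, |f ω| ≤ C) → Integrable f μ :=
    fun hf hC => Integrable.of_bound hf.aestronglyMeasurable _ (Eventually.of_forall hC)
  have hξi : ∀ n, Integrable (ξ n) μ := fun n => hint (hmξ n) (hξ n)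
  have hpull : ∀ n (f : Ω → ℝ) (C : ℝ), Measurable[ℱ n] f → (∀ ω, |f ω| ≤ C) →
      μ[f * ξ n | ℱ n] =ᵐ[μ] 0 := by
    intro n f C hf hC
    filter_upwards [condExp_stronglyMeasurable_mul_of_bound (ℱ.le n) hf.stronglyMeasurable (hξi n) C
      (Eventually.of_forall hC), hξc n] with ω h1 h2
    rw [h1, Pi.mul_apply, h2, Pi.zero_apply, mul_zero]
  have hmart : Martingale M ℱ μ := by
    refine martingale_of_condExp_sub_eq_zero_nat (fun n => (hMm n).stronglyMeasurable)
      (fun n => hint (hmM n) (hMb n)) fun n => ?_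
    have : M (n + 1) - M n = β n * ξ n := by
      funext ω
      simp [hM, Finset.sum_range_succ]
    rw [this]
    exact hpull n _ _ (hβm n) (hβ1 n)
  have hbsq : ∀ n, Integrable (fun ω => β n ω ^ 2) μ := fun n =>
    hint (C := (K + 1) ^ 2) ((hmβ n).pow_const 2) fun ω => by
      rw [abs_pow]
      exact pow_le_pow_left₀ (abs_nonneg _) (hβ1 n ω) 2
  have hMsq : ∀ n, Integrable (fun ω => M n ω ^ 2) μ := fun n =>
    hint (C := (n * (K + 1)) ^ 2) ((hmM n).pow_const 2) fun ω => by
      rw [abs_pow]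
      exact pow_le_pow_left₀ (abs_nonneg _) (hMb n ω) 2
  have hL2 : ∀ n, ∫ ω, M n ω ^ 2 ∂μ ≤ ∫ ω, ∑ k ∈ Finset.range n, β k ω ^ 2 ∂μ := by
    intro n
    induction n with
    | zero => simp [hM]
    | succ n ih =>
      have hfb : ∀ ω, |2 * M n ω * β n ω| ≤ 2 * (n * (K + 1)) * (K + 1) := fun ω => by
        rw [abs_mul, abs_mul, abs_two]
        exact mul_le_mul (mul_le_mul_of_nonneg_left (hMb n ω) (by norm_num)) (hβ1 n ω)
          (abs_nonneg _) (by positivity)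
      have hfm : Measurable[ℱ n] fun ω => 2 * M n ω * β n ω := ((hMm n).const_mul 2).mul (hβm n)
      have hcross : ∫ ω, 2 * M n ω * β n ω * ξ n ω ∂μ = 0 := by
        have h1 := integral_condExp (μ := μ) (ℱ.le n) (f := (fun ω => 2 * M n ω * β n ω) * ξ n)
        rw [integral_congr_ae (hpull n _ _ hfm hfb)] at h1
        simpa using h1.symm
      have hci : Integrable (fun ω => 2 * M n ω * β n ω * ξ n ω) μ := by
        refine hint (((hfm.mono (ℱ.le n) le_rfl)).mul (hmξ n)) (C := 2 * (n * (K + 1)) * (K + 1))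
          fun ω => ?_
        rw [abs_mul]
        exact (mul_le_mul (hfb ω) (hξ n ω) (abs_nonneg _) (by positivity)).trans (mul_one _).le
      simp only [Finset.sum_range_succ]
      rw [integral_add (integrable_finsetSum _ fun k _ => hbsq k) (hbsq n)]
      calc ∫ ω, M (n + 1) ω ^ 2 ∂μ
          ≤ ∫ ω, (M n ω ^ 2 + β n ω ^ 2) + 2 * M n ω * β n ω * ξ n ω ∂μ := by
            refine integral_mono (hMsq _) (((hMsq n).add (hbsq n)).add hci) fun ω => ?_
            have h1 : M (n + 1) ω = M n ω + β n ω * ξ n ω := by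
              simp [hM, Finset.sum_range_succ]
            have h2 : ξ n ω ^ 2 ≤ 1 := (sq_le_one_iff_abs_le_one _).2 (hξ n ω)
            have h3 := mul_le_mul_of_nonneg_left h2 (sq_nonneg (β n ω))
            simp only [h1]
            linarith
        _ = (∫ ω, M n ω ^ 2 ∂μ + ∫ ω, β n ω ^ 2 ∂μ) + ∫ ω, 2 * M n ω * β n ω * ξ n ω ∂μ := by
            rw [← integral_add (hMsq n) (hbsq n)]
            exact integral_add ((hMsq n).add (hbsq n)) hci
        _ ≤ _ := by
            rw [hcross, add_zero]
            exact add_le_add ih le_rfl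
  have hL1 : ∀ n, eLpNorm (M n) 1 μ ≤ (1 + K).toNNReal := by
    intro n
    rw [eLpNorm_one_eq_lintegral_enorm,
      ← ofReal_integral_norm_eq_lintegral_enorm (hint (hmM n) (hMb n))]
    refine ENNReal.ofReal_le_ofReal ?_
    have h1 : ∫ ω, ∑ k ∈ Finset.range n, β k ω ^ 2 ∂μ ≤ ∫ _, K ∂μ :=
      integral_mono (integrable_finsetSum _ fun k _ => hbsq k) (integrable_const K) (hβ n)
    calc ∫ ω, ‖M n ω‖ ∂μ ≤ ∫ ω, 1 + M n ω ^ 2 ∂μ := by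
          refine integral_mono (hint (hmM n) (hMb n)).norm ((integrable_const 1).add (hMsq n))
            fun ω => ?_
          simp only [Real.norm_eq_abs]
          rw [← sq_abs]
          nlinarith [sq_nonneg (|M n ω| - 1), abs_nonneg (M n ω)]
      _ = 1 + ∫ ω, M n ω ^ 2 ∂μ := by
          rw [integral_add (integrable_const 1) (hMsq n)]
          simp
      _ ≤ 1 + K := by
          rw [integral_const, probReal_univ, one_smul] at h1
          linarith [hL2 n]
  filter_upwards [hmart.submartingale.ae_tendsto_limitProcess hL1] with ω hω using ⟨_, hω⟩

/-- A martingale transform with square-summable predictable weights and bounded conditionally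
centred increments converges almost surely. -/
theorem ae_exists_tendsto_sum_mul_of_summable_sq
    (hξm : ∀ n, Measurable[ℱ (n + 1)] (ξ n)) (hξ : ∀ n ω, |ξ n ω| ≤ 1)
    (hξc : ∀ n, μ[ξ n | ℱ n] =ᵐ[μ] 0) (hβm : ∀ n, Measurable[ℱ n] (β n))
    (hβ : ∀ᵐ ω ∂μ, Summable fun n => β n ω ^ 2) :
    ∀ᵐ ω ∂μ, ∃ l, Tendsto (fun n => ∑ k ∈ Finset.range n, β k ω * ξ k ω) atTop (𝓝 l) := by
  classical
  -- Localisation: the weights are switched off once their sum of squares exceeds `K`. Including the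
  -- index `n` in the test keeps them predictable, because `β n` is already `ℱ n`-measurable.
  set βK : ℕ → ℕ → Ω → ℝ := fun K n ω =>
    if ∑ k ∈ Finset.range (n + 1), β k ω ^ 2 ≤ K then β n ω else 0 with hβK
  have hm : ∀ K n, Measurable[ℱ n] (βK K n) := fun K n => by
    have h1 : Measurable[ℱ n] fun ω => ∑ k ∈ Finset.range (n + 1), β k ω ^ 2 :=
      Finset.measurable_sum _ fun k hk =>
        ((hβm k).mono (ℱ.mono (Nat.lt_succ_iff.1 (Finset.mem_range.1 hk))) le_rfl).pow_const 2
    exact Measurable.ite (h1 measurableSet_Iic) (hβm n)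
      measurable_const
  have hle : ∀ K n ω, ∑ k ∈ Finset.range n, βK K k ω ^ 2 ≤ (K : ℝ) := by
    intro K n ω
    induction n with
    | zero => simp
    | succ n ih =>
      by_cases h : ∑ k ∈ Finset.range (n + 1), β k ω ^ 2 ≤ K
      · refine (Finset.sum_le_sum fun k _ => ?_).trans h
        simp only [hβK]
        split_ifs
        · exact le_rfl
        · simpa using sq_nonneg (β k ω)
      · rw [Finset.sum_range_succ]
        simpa [hβK, if_neg h] using ih
  have hconv := ae_all_iff.2 fun K =>
    ae_exists_tendsto_sum_mul_of_sum_sq_le hξm hξ hξc (hm K) (hle K)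
  filter_upwards [hβ, hconv] with ω h1 h2
  -- On this path the level `K` is never exceeded, so the truncated and original sums agree.
  obtain ⟨K, hK⟩ := exists_nat_ge (∑' n, β n ω ^ 2)
  obtain ⟨l, hl⟩ := h2 K
  refine ⟨l, hl.congr fun n => Finset.sum_congr rfl fun k _ => ?_⟩
  rw [hβK]
  simp only
  rw [if_pos ((h1.sum_le_tsum _ fun _ _ => sq_nonneg _).trans hK)]

end MartingaleTransform

namespace AUP

/-! ### The Bellman operator as a contraction -/

section Bellman

theorem abs_ciSup_sub_ciSup_le {A : Type*} [Finite A] [Nonempty A] {f g : A → ℝ} {c : ℝ}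
    (h : ∀ a, |f a - g a| ≤ c) : |(⨆ a, f a) - ⨆ a, g a| ≤ c := by
  have key : ∀ {f g : A → ℝ}, (∀ a, |f a - g a| ≤ c) → ⨆ a, f a ≤ (⨆ a, g a) + c :=
    fun {f g} h => ciSup_le fun a => by
      linarith [(le_abs_self _).trans (h a), le_ciSup (Set.finite_range g).bddAbove a]
  have h1 := key h
  have h2 := key fun a => (abs_sub_comm _ _).trans_le (h a)
  exact abs_sub_le_iff.2 ⟨by linarith, by linarith⟩

variable {S A : Type*} [Fintype S]

theorem sum_toReal_pmf (p : PMF S) : ∑ s, (p s).toReal = 1 := by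
  rw [← ENNReal.toReal_sum fun s _ => p.apply_ne_top s, ← tsum_fintype (L := .unconditional S),
    p.tsum_coe, ENNReal.toReal_one]

variable [Fintype A] [Nonempty A]

theorem abs_expectation_sub_le (p : PMF S) (q q' : S × A → ℝ) :
    |(∑ s', (p s').toReal * ⨆ a', q (s', a')) - ∑ s', (p s').toReal * ⨆ a', q' (s', a')|
      ≤ ‖q - q'‖ := by
  rw [← Finset.sum_sub_distrib]
  calc |∑ s', ((p s').toReal * (⨆ a', q (s', a')) - (p s').toReal * ⨆ a', q' (s', a'))|
      ≤ ∑ s', (p s').toReal * ‖q - q'‖ := by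
        refine (Finset.abs_sum_le_sum_abs _ _).trans (Finset.sum_le_sum fun s' _ => ?_)
        rw [← mul_sub, abs_mul, abs_of_nonneg ENNReal.toReal_nonneg]
        exact mul_le_mul_of_nonneg_left
          (abs_ciSup_sub_ciSup_le fun a => norm_le_pi_norm (q - q') (s', a)) ENNReal.toReal_nonneg
    _ = ‖q - q'‖ := by rw [← Finset.sum_mul, sum_toReal_pmf, one_mul]

theorem exists_isOptimalQ (T : S → A → PMF S) {γ : ℝ} (hγ₀ : 0 ≤ γ) (hγ₁ : γ < 1)
    (r : S → A → ℝ) : ∃ Q, IsOptimalQ T γ r Q := by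
  set F : (S × A → ℝ) → S × A → ℝ := fun q x =>
    r x.1 x.2 + γ * ∑ s', (T x.1 x.2 s').toReal * ⨆ a', q (s', a') with hF
  have hc : ContractingWith ⟨γ, hγ₀⟩ F := by
    refine ⟨by exact_mod_cast hγ₁, LipschitzWith.of_dist_le_mul fun q q' => ?_⟩
    rw [dist_eq_norm, dist_eq_norm]
    refine (pi_norm_le_iff_of_nonneg (by positivity)).2 fun x => ?_
    simp only [hF, Pi.sub_apply, add_sub_add_left_eq_sub, Real.norm_eq_abs, ← mul_sub]
    rw [abs_mul, abs_of_nonneg hγ₀]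
    exact mul_le_mul_of_nonneg_left (abs_expectation_sub_le _ q q') hγ₀
  refine ⟨fun s a => ContractingWith.fixedPoint F hc (s, a), fun s a => ?_⟩
  exact (congrFun (ContractingWith.fixedPoint_isFixedPt (hf := hc)) (s, a)).symm

end Bellman

/-! ### Running maximum and measurability at random indices -/

section RunningMax

/-- The running maximum of `1` and of the norms of `q 0, …, q n`. -/
noncomputable def runningMax {κ : Type*} [Fintype κ] (q : ℕ → κ → ℝ) : ℕ → ℝ
  | 0 => max 1 ‖q 0‖
  | n + 1 => max (runningMax q n) ‖q (n + 1)‖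

theorem one_le_runningMax {κ : Type*} [Fintype κ] (q : ℕ → κ → ℝ) (n : ℕ) :
    1 ≤ runningMax q n := by
  induction n with
  | zero => exact le_max_left _ _
  | succ n ih => exact ih.trans (le_max_left _ _)

theorem norm_le_runningMax {κ : Type*} [Fintype κ] (q : ℕ → κ → ℝ) (n : ℕ) :
    ‖q n‖ ≤ runningMax q n := by
  cases n <;> exact le_max_right _ _

theorem measurable_runningMax {Ω κ : Type*} [Fintype κ] {m : MeasurableSpace Ω}
    {ℱ : Filtration ℕ m} {q : ℕ → Ω → κ → ℝ} (hq : ∀ n x, Measurable[ℱ n] fun ω => q n ω x)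
    (n : ℕ) : Measurable[ℱ n] fun ω => runningMax (fun k => q k ω) n := by
  have h : ∀ n, Measurable[ℱ n] fun ω => ‖q n ω‖ := fun n =>
    measurable_norm.comp ((@measurable_pi_iff _ _ _ (ℱ n) _ _).2 (hq n))
  induction n with
  | zero => exact measurable_const.max (h 0)
  | succ n ih => exact (ih.mono (ℱ.mono n.le_succ) le_rfl).max (h (n + 1))

end RunningMax

theorem measurable_apply_of_countable {Ω κ β : Type*} {m : MeasurableSpace Ω} [MeasurableSpace κ]
    [MeasurableSpace β] [Countable κ] [MeasurableSingletonClass κ] {f : Ω → κ → β} {g : Ω → κ}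
    (hf : ∀ x, Measurable fun ω => f ω x) (hg : Measurable g) : Measurable fun ω => f ω (g ω) :=
  (measurable_from_prod_countable_left (f := fun p : Ω × κ => f p.1 p.2) hf).comp
    (measurable_id.prodMk hg)

/-! ### Q-learning with asymptotically correct rewards -/

section QLearning

variable {Ω S A : Type*} {m : MeasurableSpace Ω} {μ : Measure Ω} {ℱ : Filtration ℕ m}
  {T : S → A → PMF S} {γ : ℝ} {X : ℕ → Ω → S} {U : ℕ → Ω → A} {Y : ℕ → Ω → S} {α : ℕ → Ω → ℝ}

open Classical in
/-- The deviation of the indicator of `Y n = s'` from its conditional probability. -/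
noncomputable def transitionNoise (T : S → A → PMF S) (X : ℕ → Ω → S) (U : ℕ → Ω → A)
    (Y : ℕ → Ω → S) (s' : S) (n : ℕ) (ω : Ω) : ℝ :=
  (if Y n ω = s' then 1 else 0) - (T (X n ω) (U n ω) s').toReal

theorem abs_transitionNoise_le (s' : S) (n : ℕ) (ω : Ω) :
    |transitionNoise T X U Y s' n ω| ≤ 1 := by
  have h1 : (T (X n ω) (U n ω) s').toReal ≤ 1 :=
    ENNReal.toReal_le_of_le_ofReal zero_le_one (by simpa using PMF.coe_le_one _ _)
  have h0 : 0 ≤ (T (X n ω) (U n ω) s').toReal := ENNReal.toReal_nonneg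
  rw [transitionNoise, abs_le]
  split_ifs <;> constructor <;> linarith

open Classical in
/-- The learning rate in force at the pair `x` in step `n`. -/
noncomputable def pairRate (X : ℕ → Ω → S) (U : ℕ → Ω → A) (α : ℕ → Ω → ℝ) (n : ℕ) (ω : Ω)
    (x : S × A) : ℝ :=
  if X n ω = x.1 ∧ U n ω = x.2 then α n ω else 0

theorem pairRate_nonneg (hα : IsLearningRate μ ℱ X U α) (n : ℕ) (ω : Ω) (x : S × A) :
    0 ≤ pairRate X U α n ω x := by
  rw [pairRate]
  split_ifs
  exacts [hα.nonneg n ω, le_rfl]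

theorem ae_not_summable_pairRate (hα : IsLearningRate μ ℱ X U α) :
    ∀ᵐ ω ∂μ, ∀ x, ¬ Summable fun n => pairRate X U α n ω x := by
  classical
  filter_upwards [hα.sum_eq_top] with ω hω x hx
  refine hω x.1 x.2 (hx.congr fun n => ?_)
  simp [pairRate, Set.indicator_apply]

theorem ae_summable_pairRate_sq (hα : IsLearningRate μ ℱ X U α) :
    ∀ᵐ ω ∂μ, ∀ x, Summable fun n => pairRate X U α n ω x ^ 2 := by
  classical
  filter_upwards [hα.summable_sq] with ω hω x
  refine (hω x.1 x.2).congr fun n => ?_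
  simp only [pairRate, Set.indicator_apply, Set.mem_ofPred_eq]
  split_ifs <;> simp

variable [Fintype S] [Fintype A] [MeasurableSpace S] [DiscreteMeasurableSpace S]
  [MeasurableSpace A] [DiscreteMeasurableSpace A]

theorem measurable_transitionProb (hexp : IsExperience μ ℱ T X U Y) (s' : S) (n : ℕ) :
    Measurable[ℱ n] fun ω => (T (X n ω) (U n ω) s').toReal :=
  (Measurable.of_discrete (f := fun p : S × A => (T p.1 p.2 s').toReal)).comp
    ((hexp.measurable_state n).prodMk (hexp.measurable_action n))

theorem measurable_transitionNoise (hexp : IsExperience μ ℱ T X U Y) (s' : S) (n : ℕ) :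
    Measurable[ℱ (n + 1)] (transitionNoise T X U Y s' n) :=
  (Measurable.ite (hexp.measurable_next n (MeasurableSet.singleton s')) measurable_const
    measurable_const).sub ((measurable_transitionProb hexp s' n).mono (ℱ.mono n.le_succ) le_rfl)

theorem measurable_pairRate (hexp : IsExperience μ ℱ T X U Y) (hα : IsLearningRate μ ℱ X U α)
    (n : ℕ) (x : S × A) : Measurable[ℱ n] fun ω => pairRate X U α n ω x :=
  Measurable.ite ((hexp.measurable_state n (MeasurableSet.singleton x.1)).inter
    (hexp.measurable_action n (MeasurableSet.singleton x.2))) (hα.measurable n) measurable_const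

theorem measurable_qUpdate {Q : Ω → S → A → ℝ} {n : ℕ} {ρ : Ω → ℝ}
    (hexp : IsExperience μ ℱ T X U Y) (hα : IsLearningRate μ ℱ X U α)
    (hρ : Measurable[ℱ (n + 1)] ρ) (hQ : ∀ s a, Measurable[ℱ n] fun ω => Q ω s a) (s : S) (a : A) :
    Measurable[ℱ (n + 1)] fun ω =>
      qUpdate γ (α n ω) (ρ ω) (X n ω) (U n ω) (Y n ω) (Q ω) s a := by
  have hle : ℱ n ≤ ℱ (n + 1) := ℱ.mono n.le_succ
  have hX : Measurable[ℱ (n + 1)] (X n) := (hexp.measurable_state n).mono hle le_rfl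
  have hU : Measurable[ℱ (n + 1)] (U n) := (hexp.measurable_action n).mono hle le_rfl
  have hQ' : ∀ s a, Measurable[ℱ (n + 1)] fun ω => Q ω s a := fun s a => (hQ s a).mono hle le_rfl
  have hQXU : Measurable[ℱ (n + 1)] fun ω => Q ω (X n ω) (U n ω) :=
    measurable_apply_of_countable (f := fun ω (x : S × A) => Q ω x.1 x.2)
      (g := fun ω => (X n ω, U n ω)) (fun x => hQ' _ _)
      (hX.prodMk hU)
  have hV : Measurable[ℱ (n + 1)] fun ω => ⨆ a', Q ω (Y n ω) a' :=
    measurable_apply_of_countable (f := fun ω s' => ⨆ a', Q ω s' a')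
      (fun s' => Measurable.iSup fun a' => hQ' s' a') (hexp.measurable_next n)
  refine Measurable.ite ?_ (hQXU.add (((hα.measurable n).mono hle le_rfl).mul
    ((hρ.add (hV.const_mul γ)).sub hQXU))) (hQ' s a)
  have h := (hX (MeasurableSet.singleton s)).inter (hU (MeasurableSet.singleton a))
  convert h using 1
  ext ω
  simp [eq_comm]

theorem measurable_auxQ (hexp : IsExperience μ ℱ T X U Y) (hα : IsLearningRate μ ℱ X U α)
    {ι : Type*} (r : ι → S → A → ℝ) {q₀ : Ω → ι → S → A → ℝ}
    (hq₀ : ∀ i s a, Measurable[ℱ 0] fun ω => q₀ ω i s a) (n : ℕ) (i : ι) :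
    ∀ s a, Measurable[ℱ n] fun ω => auxQ γ r X U Y α q₀ n ω i s a := by
  induction n with
  | zero => exact hq₀ i
  | succ n ih =>
    refine measurable_qUpdate hexp hα ?_ ih
    exact ((Measurable.of_discrete (f := fun p : S × A => r i p.1 p.2)).comp
      ((hexp.measurable_state n).prodMk (hexp.measurable_action n))).mono (ℱ.mono n.le_succ) le_rfl

theorem measurable_aupQ (hexp : IsExperience μ ℱ T X U Y) (hα : IsLearningRate μ ℱ X U α)
    {ι : Type*} [Fintype ι] (noop : A) (lam : ℝ) (R : S → A → ℝ) (r : ι → S → A → ℝ) {q₀ : Ω → ι → S → A → ℝ}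
    (hq₀ : ∀ i s a, Measurable[ℱ 0] fun ω => q₀ ω i s a)
    {Sc : ℕ → Ω → S → ℝ} (hSc : ∀ n s, Measurable[ℱ n] fun ω => Sc n ω s) {δ : ℕ} (hδ : δ ≤ 1)
    {p₀ : Ω → S → A → ℝ} (hp₀ : ∀ s a, Measurable[ℱ 0] fun ω => p₀ ω s a) (n : ℕ) :
    ∀ s a, Measurable[ℱ n] fun ω => aupQ noop γ lam R r X U Y α q₀ Sc δ p₀ n ω s a := by
  induction n with
  | zero => exact hp₀
  | succ n ih =>
    refine measurable_qUpdate hexp hα ?_ ih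
    -- Even with `δ = 1` the reward is known at time `n + 1`, which is all that adaptedness of the
    -- next iterate needs.
    have hle : ℱ (n + δ) ≤ ℱ (n + 1) := ℱ.mono (by omega)
    have haux : ∀ i s a, Measurable[ℱ (n + 1)] fun ω => auxQ γ r X U Y α q₀ (n + δ) ω i s a :=
      fun i s a => (measurable_auxQ hexp hα r hq₀ _ i s a).mono hle le_rfl
    refine measurable_apply_of_countable
      (f := fun ω (x : S × A) => aupReward noop R lam (auxQ γ r X U Y α q₀ (n + δ) ω)
        (Sc (n + δ) ω) x.1 x.2) (g := fun ω => (X n ω, U n ω)) (fun x => ?_)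
      (((hexp.measurable_state n).mono (ℱ.mono n.le_succ) le_rfl).prodMk
        ((hexp.measurable_action n).mono (ℱ.mono n.le_succ) le_rfl))
    refine measurable_const.sub (Measurable.const_mul (Measurable.div ?_
      ((hSc _ _).mono hle le_rfl)) lam)
    exact Finset.measurable_sum _ fun i _ => measurable_norm.comp ((haux _ _ _).sub (haux _ _ _))

variable [IsProbabilityMeasure μ]

theorem condExp_transitionNoise (hexp : IsExperience μ ℱ T X U Y) (s' : S) (n : ℕ) :
    μ[transitionNoise T X U Y s' n | ℱ n] =ᵐ[μ] 0 := by
  have hT := measurable_transitionProb hexp s' n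
  have hTi : Integrable (fun ω => (T (X n ω) (U n ω) s').toReal) μ := by
    refine Integrable.of_bound (hT.mono (ℱ.le n) le_rfl).aestronglyMeasurable 1
      (Eventually.of_forall fun ω => ?_)
    rw [Real.norm_of_nonneg ENNReal.toReal_nonneg]
    exact ENNReal.toReal_le_of_le_ofReal zero_le_one (by simpa using PMF.coe_le_one _ _)
  have hY : MeasurableSet (Y n ⁻¹' {s'}) :=
    ((hexp.measurable_next n).mono (ℱ.le _) le_rfl) (MeasurableSet.singleton s')
  have e : transitionNoise T X U Y s' n
      = (Y n ⁻¹' {s'}).indicator (fun _ => (1 : ℝ)) - fun ω => (T (X n ω) (U n ω) s').toReal := by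
    classical
    funext ω
    simp [transitionNoise, Set.indicator_apply]
  rw [e]
  filter_upwards [condExp_sub ((integrable_const (1 : ℝ)).indicator hY) hTi (ℱ n),
    hexp.law_next n s'] with ω h1 h2
  rw [h1, Pi.sub_apply, h2, condExp_of_stronglyMeasurable (ℱ.le n) hT.stronglyMeasurable hTi,
    sub_self, Pi.zero_apply]

/-- Q-learning with an adapted process of Q-functions and rewards that are asymptotically those of
a reward function converges to the optimal Q-function of the latter. -/
theorem ae_tendsto_of_qUpdate (hγ₀ : 0 ≤ γ) (hγ₁ : γ < 1) (hexp : IsExperience μ ℱ T X U Y)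
    (hα : IsLearningRate μ ℱ X U α) {Q : ℕ → Ω → S → A → ℝ} {ρ : ℕ → Ω → ℝ}
    (hQm : ∀ n s a, Measurable[ℱ n] fun ω => Q n ω s a)
    (hQ : ∀ n ω, Q (n + 1) ω = qUpdate γ (α n ω) (ρ n ω) (X n ω) (U n ω) (Y n ω) (Q n ω)) :
    ∀ᵐ ω ∂μ, ∀ r Qlim : S → A → ℝ, IsOptimalQ T γ r Qlim →
      Tendsto (fun n => ρ n ω - r (X n ω) (U n ω)) atTop (𝓝 0) →
      ∀ s a, Tendsto (fun n => Q n ω s a) atTop (𝓝 (Qlim s a)) := by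
  classical
  obtain ⟨ω₀⟩ : Nonempty Ω := nonempty_of_isProbabilityMeasure μ
  have : Nonempty A := ⟨U 0 ω₀⟩
  set q : ℕ → Ω → S × A → ℝ := fun n ω x => Q n ω x.1 x.2 with hq
  set G : ℕ → Ω → ℝ := fun n ω => runningMax (fun k => q k ω) n with hG
  set V : ℕ → Ω → S → ℝ := fun n ω s' => ⨆ a', Q n ω s' a' with hV
  have hG1 : ∀ n ω, 1 ≤ G n ω := fun n ω => one_le_runningMax _ n
  have hVG : ∀ n ω s', |V n ω s' / G n ω| ≤ 1 := by
    intro n ω s'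
    have h0 : (0 : ℝ) < G n ω := one_pos.trans_le (hG1 n ω)
    rw [abs_div, abs_of_pos h0, div_le_one h0]
    have h := abs_ciSup_sub_ciSup_le (f := fun a => Q n ω s' a) (g := fun _ => 0) (c := G n ω)
      fun a => by
        rw [sub_zero]
        exact (norm_le_pi_norm (q n ω) (s', a)).trans (norm_le_runningMax (fun k => q k ω) n)
    simpa [hV] using h
  -- The noise in the value of the next state is expanded over the finitely many `s'`. Normalised by
  -- `G`, each weight is bounded by the learning rate and so inherits square summability.
  set β : S × A → S → ℕ → Ω → ℝ := fun x s' n ω =>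
    pairRate X U α n ω x * (V n ω s' / G n ω) with hβ
  have hβm : ∀ x s' n, Measurable[ℱ n] (β x s' n) := fun x s' n =>
    (measurable_pairRate hexp hα n x).mul
      ((Measurable.iSup fun a => hQm n s' a).div (measurable_runningMax (fun n x => hQm n _ _) n))
  have hβs : ∀ x s', ∀ᵐ ω ∂μ, Summable fun n => β x s' n ω ^ 2 := by
    intro x s'
    filter_upwards [ae_summable_pairRate_sq hα] with ω hω
    refine (hω x).of_nonneg_of_le (fun n => sq_nonneg _) fun n => ?_
    rw [hβ]
    simp only [mul_pow]
    exact mul_le_of_le_one_right (sq_nonneg _) ((sq_le_one_iff_abs_le_one _).2 (hVG n ω s'))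
  have hnoise : ∀ᵐ ω ∂μ, ∀ x s', ∃ l, Tendsto (fun n => ∑ k ∈ Finset.range n,
      β x s' k ω * transitionNoise T X U Y s' k ω) atTop (𝓝 l) :=
    ae_all_iff.2 fun x => ae_all_iff.2 fun s' => ae_exists_tendsto_sum_mul_of_summable_sq
      (measurable_transitionNoise hexp s') (abs_transitionNoise_le s')
      (condExp_transitionNoise hexp s') (hβm x s') (hβs x s')
  -- The exceptional null set depends only on noise and rates. Hence `r` and `Qlim` can be chosen
  -- after `ω`, as the random limit of the scale requires.
  filter_upwards [hnoise, ae_summable_pairRate_sq hα, ae_not_summable_pairRate hα]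
    with ω hω hsq hsum r Qlim hopt hρ
  set e : ℕ → ℝ := fun n => ρ n ω - r (X n ω) (U n ω) with he
  -- The target is the expected Bellman backup plus the reward error. The error appears at every
  -- pair, which is harmless because unvisited pairs have rate `0`.
  have hscheme : IsScheme (fun n => q n ω) (fun n => pairRate X U α n ω)
      (fun n x => r x.1 x.2 + e n + γ * ∑ s', (T x.1 x.2 s').toReal * V n ω s')
      (fun n x => γ * ∑ s', β x s' n ω * transitionNoise T X U Y s' n ω) (fun n => G n ω) :=
    { step := fun n x => by
        have h0 : G n ω ≠ 0 := (one_pos.trans_le (hG1 n ω)).ne'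
        simp only [hq, hQ, qUpdate, hβ, pairRate]
        by_cases hx : X n ω = x.1 ∧ U n ω = x.2
        · have hx' : x.1 = X n ω ∧ x.2 = U n ω := ⟨hx.1.symm, hx.2.symm⟩
          have h1 : ∑ s', α n ω * (V n ω s' / G n ω) * transitionNoise T X U Y s' n ω
              = α n ω / G n ω *
                (V n ω (Y n ω) - ∑ s', (T (X n ω) (U n ω) s').toReal * V n ω s') := by
            simp only [transitionNoise, mul_sub, Finset.sum_sub_distrib, Finset.mul_sum]
            congr 1
            · simp only [mul_ite, mul_one, mul_zero, Finset.sum_ite_eq, Finset.mem_univ, if_true]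
              ring
            · exact Finset.sum_congr rfl fun _ _ => by ring
          simp only [if_pos hx, if_pos hx', h1]
          simp only [hx'.1, hx'.2, he]
          rw [show (⨆ a', Q n ω (Y n ω) a') = V n ω (Y n ω) from rfl]
          field_simp
          ring
        · have hx' : ¬ (x.1 = X n ω ∧ x.2 = U n ω) := fun h => hx ⟨h.1.symm, h.2.symm⟩
          simp [if_neg hx, if_neg hx']
      rate_nonneg := fun n x => pairRate_nonneg hα n ω x
      norm_le := le_max_right _ _
      max_succ := fun n => rfl }
  have hlim : Tendsto (fun n => q n ω) atTop (𝓝 fun x => Qlim x.1 x.2) := by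
    refine hscheme.tendsto (fun x => ?_) hsum (fun x => ?_) hγ₀ hγ₁ (e := fun n => |e n|)
      (by simpa using hρ.abs) fun n x => ?_
    -- Rates above `1` may occur early; square summability makes the rates tend to `0`.
    · filter_upwards [(hsq x).tendsto_atTop_zero.eventually_le_const one_pos] with n hn
      exact (le_abs_self _).trans ((sq_le_one_iff_abs_le_one _).1 hn)
    · choose l hl using hω x
      refine ⟨γ * ∑ s', l s', ((tendsto_finsetSum Finset.univ fun s' _ => hl s').const_mul
        γ).congr fun n => ?_⟩
      rw [Finset.sum_comm, Finset.mul_sum]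
    · have h1 := abs_expectation_sub_le (T x.1 x.2) (q n ω) fun x => Qlim x.1 x.2
      have h2 := mul_le_mul_of_nonneg_left h1 hγ₀
      rw [hopt x.1 x.2]
      have h3 : r x.1 x.2 + e n + γ * ∑ s', (T x.1 x.2 s').toReal * V n ω s'
          - (r x.1 x.2 + γ * ∑ s', (T x.1 x.2 s').toReal * ⨆ a', Qlim s' a')
          = γ * (∑ s', (T x.1 x.2 s').toReal * V n ω s'
            - ∑ s', (T x.1 x.2 s').toReal * ⨆ a', Qlim s' a') + e n := by ring
      rw [h3]
      refine (abs_add_le _ _).trans (add_le_add ?_ le_rfl)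
      rw [abs_mul, abs_of_nonneg hγ₀]
      exact h2
  exact fun s a => tendsto_pi_nhds.1 hlim (s, a)

end QLearning

/-! ### Convergence of the AUP reward and conclusion -/

theorem tendsto_aupReward {S A ι : Type*} [Fintype ι] {l : Filter ℕ} (noop : A) (R : S → A → ℝ)
    (lam : ℝ) {Q : ℕ → ι → S → A → ℝ} {Qlim : ι → S → A → ℝ} {sc : ℕ → S → ℝ} {sclim : S → ℝ}
    (hQ : ∀ i s a, Tendsto (fun n => Q n i s a) l (𝓝 (Qlim i s a)))
    (hsc : ∀ s, Tendsto (fun n => sc n s) l (𝓝 (sclim s))) (h₀ : ∀ s, sclim s ≠ 0) (s : S) (a : A) :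
    Tendsto (fun n => aupReward noop R lam (Q n) (sc n) s a) l
      (𝓝 (aupReward noop R lam Qlim sclim s a)) :=
  tendsto_const_nhds.sub (Tendsto.const_mul lam (Tendsto.div
    (tendsto_finsetSum _ fun i _ => ((hQ i s a).sub (hQ i s noop)).abs) (hsc s) (h₀ s)))

/-- Pointwise convergence on a finite set is uniform, so the evaluation point may move with `n`. -/
theorem tendsto_eval_sub_eval {κ : Type*} [Finite κ] {f : ℕ → κ → ℝ} {g : κ → ℝ}
    (h : ∀ x, Tendsto (fun n => f n x) atTop (𝓝 (g x))) (x : ℕ → κ) :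
    Tendsto (fun n => f n (x n) - g (x n)) atTop (𝓝 0) := by
  rw [Metric.tendsto_nhds]
  intro ε hε
  filter_upwards [eventually_all.2 fun y => Metric.tendsto_nhds.1 (h y) ε hε] with n hn
  simpa [Real.dist_eq] using hn (x n)

end AUP

theorem theorem1 {Ω S A ι : Type*} [Fintype S] [Fintype A] [Fintype ι]
    [MeasurableSpace S] [DiscreteMeasurableSpace S]
    [MeasurableSpace A] [DiscreteMeasurableSpace A]
    {m : MeasurableSpace Ω} (μ : Measure Ω) [IsProbabilityMeasure μ] (ℱ : Filtration ℕ m)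
    -- the MDP with its no-op action, and the auxiliary rewards
    (T : S → A → PMF S) (R : S → A → ℝ) (γ : ℝ) (hγ₀ : 0 ≤ γ) (hγ₁ : γ < 1) (noop : A)
    (lam : ℝ) (hlam : 0 ≤ lam) (r : ι → S → A → ℝ)
    -- the experiences and the learning rates
    (X : ℕ → Ω → S) (U : ℕ → Ω → A) (Y : ℕ → Ω → S) (hexp : AUP.IsExperience μ ℱ T X U Y)
    (hvisit : AUP.InfiniteExploration μ X U)
    (α : ℕ → Ω → ℝ) (hα : AUP.IsLearningRate μ ℱ X U α)
    -- the initial values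
    (q₀ : Ω → ι → S → A → ℝ) (hq₀ : ∀ i s a, Measurable[ℱ 0] fun ω => q₀ ω i s a)
    (p₀ : Ω → S → A → ℝ) (hp₀ : ∀ s a, Measurable[ℱ 0] fun ω => p₀ ω s a)
    -- the scale, which is computed online and converges to a positive limit
    (Sc : ℕ → Ω → S → ℝ) (hSc : ∀ n s, Measurable[ℱ n] fun ω => Sc n ω s)
    (Sclim : Ω → S → ℝ)
    (hSclim : ∀ᵐ ω ∂μ, ∀ s, 0 < Sclim ω s ∧ Tendsto (fun n => Sc n ω s) atTop (𝓝 (Sclim ω s)))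
    -- whether the reward is computed before or after the auxiliary updates of the step
    (δ : ℕ) (hδ : δ ≤ 1) :
    ∃ Qaux : ι → S → A → ℝ, (∀ i, AUP.IsOptimalQ T γ (r i) (Qaux i)) ∧
      ∀ᵐ ω ∂μ,
        (∀ i s a, Tendsto (fun n => AUP.auxQ γ r X U Y α q₀ n ω i s a) atTop
          (𝓝 (Qaux i s a))) ∧
        ∃ Qaup : S → A → ℝ,
          AUP.IsOptimalQ T γ (AUP.aupReward noop R lam Qaux (Sclim ω)) Qaup ∧
          ∀ s a, Tendsto
            (fun n => AUP.aupQ noop γ lam R r X U Y α q₀ Sc δ p₀ n ω s a) atTop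
            (𝓝 (Qaup s a)) := by
  have : Nonempty A := ⟨noop⟩
  choose Qaux hQaux using fun i => AUP.exists_isOptimalQ T hγ₀ hγ₁ (r i)
  refine ⟨Qaux, hQaux, ?_⟩
  have haux := AUP.measurable_auxQ (γ := γ) hexp hα r hq₀
  have hconv := ae_all_iff.2 fun i => AUP.ae_tendsto_of_qUpdate hγ₀ hγ₁ hexp hα
    (Q := fun n ω => AUP.auxQ γ r X U Y α q₀ n ω i) (ρ := fun n ω => r i (X n ω) (U n ω))
    (fun n => haux n i) fun n ω => rfl
  have hconv' := AUP.ae_tendsto_of_qUpdate hγ₀ hγ₁ hexp hα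
    (AUP.measurable_aupQ (γ := γ) hexp hα noop lam R r hq₀ hSc hδ hp₀) fun n ω => rfl
  filter_upwards [hconv, hconv', hSclim] with ω h1 h2 h3
  have hlim : ∀ i s a, Tendsto (fun n => AUP.auxQ γ r X U Y α q₀ n ω i s a) atTop
      (𝓝 (Qaux i s a)) := fun i => h1 i (r i) (Qaux i) (hQaux i) (by simp)
  refine ⟨hlim, ?_⟩
  -- The limiting AUP reward depends on `ω` through `Sclim ω`, so its optimal Q-function is chosen
  -- path by path.
  obtain ⟨Qaup, hQaup⟩ :=
    AUP.exists_isOptimalQ T hγ₀ hγ₁ (AUP.aupReward noop R lam Qaux (Sclim ω))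
  refine ⟨Qaup, hQaup, h2 _ Qaup hQaup ?_⟩
  have hshift := tendsto_add_atTop_nat δ
  exact AUP.tendsto_eval_sub_eval
    (f := fun n (x : S × A) => AUP.aupReward noop R lam (AUP.auxQ γ r X U Y α q₀ (n + δ) ω)
      (Sc (n + δ) ω) x.1 x.2)
    (fun x => AUP.tendsto_aupReward noop R lam (fun i s a => (hlim i s a).comp hshift)
      (fun s => (h3 s).2.comp hshift) (fun s => (h3 s).1.ne') x.1 x.2)
    fun n => (X n ω, U n ω)
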